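/- Equip $\mathbb R^d$ with the supremum norm $\|\cdot\|$. A set $\Lambda\subset\mathbb R^d$ is a *Delone set* if there are $r,R>0$ such that every ball of radius $r$ contains at most one point of $\Lambda$ and every ball of radius $R$ contains at least one point of $\Lambda$. Two sets $\Lambda,\Gamma\subset\mathbb R^d$ are *bounded-displacement (BD) equivalent* if there is a bijection $\phi:\Lambda\to\Gamma$ with $\sup_{x\in\Lambda}\|x-\phi(x)\|<\infty$; a Delone set is *uniformly spread* if it is BD-equivalent to a (full-rank) lattice in $\mathbb R^d$. The *Chabauty–Fell topology* on the set $\mathscr C(\mathbb R^d)$ of closed subsets of $\mathbb R^d$ is the topology of the metric $$D(\Lambda_0,\Lambda_1)=\inf\Bigl(\bigl\{\varepsilon>0 : \Lambda_0\cap B(0,1/\varepsilon)\subset\Lambda_1^{(+\varepsilon)},\ \Lambda_1\cap B(0,1/\varepsilon)\subset\Lambda_0^{(+\varepsilon)}\bigr\}\cup\{1\}\Bigr),$$ where $B(0,s)$ is the open ball and $A^{(+\varepsilon)}$ is the set of points at distance at most $\varepsilon$ from $A$ (with $\emptyset^{(+\varepsilon)}=\emptyset$). **Theorem 1.1.** Let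 $\mathbb X\subset\mathscr C(\mathbb R^d)$ be a nonempty, translation-invariant set of Delone sets in $\mathbb R^d$ that is compact in the Chabauty–Fell topology and minimal under translations, that is, for every $\Lambda\in\mathbb X$ the orbit $\{\Lambda+v : v\in\mathbb R^d\}$ is dense in $\mathbb X$. Let $\mathrm{BD}(\mathbb X)$ be the cardinality of the set of BD-equivalence classes represented by elements of $\mathbb X$. Then exactly one of the following holds: 1. there exists a uniformly spread Delone set in $\mathbb X$; 2. $\mathrm{BD}(\mathbb X)=2^{\aleph_0}$. Moreover, if (1) holds, then every $\Lambda\in\mathbb X$ is uniformly spread and $\mathrm{BD}(\mathbb X)=1$. -/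

import Mathlib

namespace DeloneBD

open Set

/-- The set `𝒞(ℝ^d)` of all closed subsets of `ℝ^d`. A synonym of Mathlib's `Closeds`, because the
latter carries the Hausdorff distance, not the Chabauty--Fell topology. Throughout, `ℝ^d` is
`Fin d → ℝ` with the supremum norm. -/
def ClosedSubset (d : ℕ) : Type := TopologicalSpace.Closeds (Fin d → ℝ)

variable {d : ℕ}

instance : SetLike (ClosedSubset d) (Fin d → ℝ) :=
  inferInstanceAs (SetLike (TopologicalSpace.Closeds (Fin d → ℝ)) (Fin d → ℝ))

theorem ClosedSubset.isClosed (Λ : ClosedSubset d) : IsClosed (Λ : Set (Fin d → ℝ)) :=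
  TopologicalSpace.Closeds.isClosed Λ

/-- `Λ ∩ B(0, 1/ε) ⊆ Γ^(+ε)` and `Γ ∩ B(0, 1/ε) ⊆ Λ^(+ε)`, where `A^(+ε)` is the set of points at
distance at most `ε` from `A`. -/
def CFClose (Λ Γ : Set (Fin d → ℝ)) (ε : ℝ) : Prop :=
  Λ ∩ Metric.ball 0 (1 / ε) ⊆ Metric.cthickening ε Γ ∧
    Γ ∩ Metric.ball 0 (1 / ε) ⊆ Metric.cthickening ε Λ

/-- The Chabauty--Fell metric on closed subsets of `ℝ^d`. -/
noncomputable def cfDist (Λ Γ : Set (Fin d → ℝ)) : ℝ :=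
  sInf ({ε : ℝ | 0 < ε ∧ CFClose Λ Γ ε} ∪ {1})

theorem CFClose.symm {Λ Γ : Set (Fin d → ℝ)} {ε : ℝ} (h : CFClose Λ Γ ε) : CFClose Γ Λ ε :=
  ⟨h.2, h.1⟩

theorem CFClose.mono {Λ Γ : Set (Fin d → ℝ)} {ε δ : ℝ} (hε : 0 < ε) (hεδ : ε ≤ δ)
    (h : CFClose Λ Γ ε) : CFClose Λ Γ δ := by
  have hb : Metric.ball (0 : Fin d → ℝ) (1 / δ) ⊆ Metric.ball 0 (1 / ε) :=
    Metric.ball_subset_ball (one_div_le_one_div_of_le hε hεδ)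
  exact ⟨((inter_subset_inter_right _ hb).trans h.1).trans (Metric.cthickening_mono hεδ _),
    ((inter_subset_inter_right _ hb).trans h.2).trans (Metric.cthickening_mono hεδ _)⟩

theorem cfDist_bddBelow (Λ Γ : Set (Fin d → ℝ)) :
    BddBelow ({ε : ℝ | 0 < ε ∧ CFClose Λ Γ ε} ∪ {1}) :=
  ⟨0, by rintro ε (h | h)
         · exact h.1.le
         · rw [mem_singleton_iff.1 h]; exact zero_le_one⟩

theorem cfDist_nonneg (Λ Γ : Set (Fin d → ℝ)) : 0 ≤ cfDist Λ Γ :=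
  le_csInf ⟨1, Or.inr rfl⟩ (by
    rintro ε (h | h)
    · exact h.1.le
    · rw [mem_singleton_iff.1 h]; exact zero_le_one)

theorem cfDist_le_one (Λ Γ : Set (Fin d → ℝ)) : cfDist Λ Γ ≤ 1 :=
  csInf_le (cfDist_bddBelow Λ Γ) (Or.inr rfl)

theorem cfDist_le {Λ Γ : Set (Fin d → ℝ)} {ε : ℝ} (hε : 0 < ε) (h : CFClose Λ Γ ε) :
    cfDist Λ Γ ≤ ε :=
  csInf_le (cfDist_bddBelow Λ Γ) (Or.inl ⟨hε, h⟩)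

theorem cfClose_of_cfDist_lt {Λ Γ : Set (Fin d → ℝ)} {ε : ℝ} (h : cfDist Λ Γ < ε) (h1 : ε ≤ 1) :
    CFClose Λ Γ ε := by
  have hne : ({ε : ℝ | 0 < ε ∧ CFClose Λ Γ ε} ∪ {1}).Nonempty := ⟨1, Or.inr rfl⟩
  obtain ⟨δ, hδ | hδ, hlt⟩ := exists_lt_of_csInf_lt hne h
  · exact hδ.2.mono hδ.1 hlt.le
  · rw [mem_singleton_iff.1 hδ] at hlt
    exact absurd hlt (not_lt.2 h1)

theorem cfDist_comm (Λ Γ : Set (Fin d → ℝ)) : cfDist Λ Γ = cfDist Γ Λ := by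
  have : {ε : ℝ | 0 < ε ∧ CFClose Λ Γ ε} = {ε : ℝ | 0 < ε ∧ CFClose Γ Λ ε} := by
    ext ε
    exact ⟨fun h => ⟨h.1, h.2.symm⟩, fun h => ⟨h.1, h.2.symm⟩⟩
  rw [cfDist, cfDist, this]

theorem cfDist_self (Λ : Set (Fin d → ℝ)) : cfDist Λ Λ = 0 := by
  refine le_antisymm (le_of_forall_pos_le_add fun ε hε => ?_) (cfDist_nonneg _ _)
  rw [zero_add]
  have h : Λ ∩ Metric.ball 0 (1 / ε) ⊆ Metric.cthickening ε Λ :=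
    inter_subset_left.trans (Metric.self_subset_cthickening Λ)
  exact cfDist_le hε ⟨h, h⟩

theorem subset_of_cfDist_eq_zero {Λ Γ : Set (Fin d → ℝ)} (hΓ : IsClosed Γ)
    (h : cfDist Λ Γ = 0) : Λ ⊆ Γ := by
  intro x hx
  rw [← hΓ.closure_eq, Metric.closure_eq_iInter_cthickening]
  refine mem_iInter₂.2 fun δ hδ => ?_
  have hn : 0 < ‖x‖ + 1 := by positivity
  set ε : ℝ := min δ (min 1 (1 / (‖x‖ + 1))) with hεdef
  have hε : 0 < ε := lt_min hδ (lt_min one_pos (by positivity))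
  have hε' : ε ≤ 1 / (‖x‖ + 1) := (min_le_right _ _).trans (min_le_right _ _)
  have hc := cfClose_of_cfDist_lt (h.trans_lt hε) ((min_le_right _ _).trans (min_le_left _ _))
  refine Metric.cthickening_mono (min_le_left _ _) _ (hc.1 ⟨hx, ?_⟩)
  rw [mem_ball_zero_iff]
  have := (le_one_div hn hε).2 hε'
  linarith

theorem cfClose_trans_aux {A B C : Set (Fin d → ℝ)} {a b : ℝ} (ha : 0 < a) (hb : 0 < b)
    (hab : a + b < 1) (h1 : A ∩ Metric.ball 0 (1 / a) ⊆ Metric.cthickening a B)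
    (h2 : B ∩ Metric.ball 0 (1 / b) ⊆ Metric.cthickening b C) :
    A ∩ Metric.ball 0 (1 / (a + b)) ⊆ Metric.cthickening (a + b) C := by
  rintro x ⟨hxA, hx⟩
  have hxB := h1 ⟨hxA, Metric.ball_subset_ball
    (one_div_le_one_div_of_le ha (by linarith)) hx⟩
  have key : 1 / (a + b) + a < 1 / b := by
    have : 1 / b - (1 / (a + b) + a) = a * (1 - b * (a + b)) / (b * (a + b)) := by
      field_simp
      ring
    have hpos : 0 < a * (1 - b * (a + b)) / (b * (a + b)) :=
      div_pos (mul_pos ha (by nlinarith)) (by positivity)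
    linarith
  rw [mem_ball_zero_iff] at hx
  rw [Metric.mem_cthickening_iff] at hxB ⊢
  refine ENNReal.le_of_forall_pos_le_add fun η hη _ => ?_
  set t : ℝ := a + min (η : ℝ) (1 / b - (1 / (a + b) + a)) with ht
  have htpos : a < t := by
    have : 0 < min (η : ℝ) (1 / b - (1 / (a + b) + a)) := lt_min (by exact_mod_cast hη) (by linarith)
    linarith
  have hlt : Metric.infEDist x B < ENNReal.ofReal t :=
    hxB.trans_lt ((ENNReal.ofReal_lt_ofReal_iff (by linarith)).2 htpos)
  obtain ⟨y, hyB, hy⟩ := Metric.infEDist_lt_iff.1 hlt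
  rw [edist_dist, ENNReal.ofReal_lt_ofReal_iff (by linarith)] at hy
  have hyn : ‖y‖ < 1 / b := by
    have h3 : ‖y‖ ≤ ‖x‖ + dist x y := by
      rw [dist_comm, dist_eq_norm]
      calc ‖y‖ = ‖x + (y - x)‖ := by congr 1; abel
        _ ≤ _ := norm_add_le _ _
    have h4 := min_le_right (η : ℝ) (1 / b - (1 / (a + b) + a))
    linarith
  have hyC := h2 ⟨hyB, mem_ball_zero_iff.2 hyn⟩
  rw [Metric.mem_cthickening_iff] at hyC
  have h5 : dist x y ≤ a + η := hy.le.trans (by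
    have := min_le_left (η : ℝ) (1 / b - (1 / (a + b) + a))
    linarith)
  calc Metric.infEDist x C ≤ edist x y + Metric.infEDist y C := Metric.infEDist_le_edist_add_infEDist
    _ ≤ ENNReal.ofReal (a + η) + ENNReal.ofReal b := by
        gcongr
        rw [edist_dist]
        exact ENNReal.ofReal_le_ofReal h5
    _ = ENNReal.ofReal (a + b) + η := by
        rw [ENNReal.ofReal_add ha.le (NNReal.coe_nonneg η), ENNReal.ofReal_add ha.le hb.le,
          ENNReal.ofReal_coe_nnreal]
        ring

theorem cfDist_triangle (A B C : Set (Fin d → ℝ)) : cfDist A C ≤ cfDist A B + cfDist B C := by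
  by_contra! hcon
  set η := (cfDist A C - (cfDist A B + cfDist B C)) / 3 with hη
  have hηpos : 0 < η := by rw [hη]; linarith
  have hA := cfDist_nonneg A B
  have hB := cfDist_nonneg B C
  have h1 := cfDist_le_one A C
  have hs : cfDist A B + η + (cfDist B C + η) < cfDist A C := by linarith
  have hAB := cfClose_of_cfDist_lt (Λ := A) (Γ := B) (ε := cfDist A B + η) (by linarith) (by linarith)
  have hBC := cfClose_of_cfDist_lt (Λ := B) (Γ := C) (ε := cfDist B C + η) (by linarith) (by linarith)
  have h : CFClose A C (cfDist A B + η + (cfDist B C + η)) := by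
    refine ⟨cfClose_trans_aux (by linarith) (by linarith) (by linarith) hAB.1 hBC.1, ?_⟩
    rw [add_comm]
    exact cfClose_trans_aux (by linarith) (by linarith) (by linarith) hBC.2 hAB.2
  have hpos : 0 < cfDist A B + η + (cfDist B C + η) := by linarith
  exact absurd (cfDist_le hpos h) (not_le.2 hs)

/-- `𝒞(ℝ^d)` with the metric `cfDist`; the topology of this metric is the Chabauty--Fell
topology. -/
noncomputable instance : MetricSpace (ClosedSubset d) where
  dist Λ Γ := cfDist (Λ : Set (Fin d → ℝ)) (Γ : Set (Fin d → ℝ))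
  dist_self Λ := cfDist_self _
  dist_comm Λ Γ := cfDist_comm _ _
  dist_triangle Λ Γ Δ := cfDist_triangle _ _ _
  eq_of_dist_eq_zero {Λ Γ} h := SetLike.coe_injective <|
    (subset_of_cfDist_eq_zero Γ.isClosed h).antisymm
      (subset_of_cfDist_eq_zero Λ.isClosed ((cfDist_comm _ _).trans h))

/-- The action of `ℝ^d` on `𝒞(ℝ^d)` by translations: `v +ᵥ Λ = {v + x | x ∈ Λ}`. -/
instance : AddAction (Fin d → ℝ) (ClosedSubset d) where
  vadd v Λ := (⟨(fun x => v + x) '' (Λ : Set (Fin d → ℝ)),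
    (Homeomorph.addLeft v).isClosedMap _ Λ.isClosed⟩ : TopologicalSpace.Closeds (Fin d → ℝ))
  zero_vadd Λ := SetLike.coe_injective (by
    change (fun x => 0 + x) '' (Λ : Set (Fin d → ℝ)) = Λ
    simp)
  add_vadd v w Λ := SetLike.coe_injective (by
    change (fun x => v + w + x) '' (Λ : Set (Fin d → ℝ)) =
      (fun x => v + x) '' ((fun x => w + x) '' (Λ : Set (Fin d → ℝ)))
    simp only [image_image, add_assoc])

/-- `Λ ⊆ ℝ^d` is a Delone set: it is uniformly discrete and relatively dense. (Mathlib's `DeloneSet`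
is a set bundled with a choice of the two radii.) -/
def IsDelone (Λ : Set (Fin d → ℝ)) : Prop :=
  ∃ D : Delone.DeloneSet (Fin d → ℝ), D.carrier = Λ

/-- Bounded displacement equivalence: there is a bijection `φ : Λ → Γ` with
`sup ‖x - φ x‖ < ∞`. -/
def BDEquiv (Λ Γ : Set (Fin d → ℝ)) : Prop :=
  ∃ φ : Λ ≃ Γ, ∃ C : ℝ, ∀ x : Λ, ‖(x : Fin d → ℝ) - (φ x : Fin d → ℝ)‖ ≤ C

/-- Bounded displacement equivalence as an equivalence relation on subsets of `ℝ^d`. -/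
def bdSetoid (d : ℕ) : Setoid (Set (Fin d → ℝ)) where
  r := BDEquiv
  iseqv :=
    { refl := fun Λ => ⟨Equiv.refl Λ, 0, fun x => by simp⟩
      symm := by
        rintro Λ Γ ⟨φ, C, h⟩
        refine ⟨φ.symm, C, fun y => ?_⟩
        have := h (φ.symm y)
        rwa [Equiv.apply_symm_apply, norm_sub_rev] at this
      trans := by
        rintro Λ Γ Δ ⟨φ, C, h⟩ ⟨ψ, C', h'⟩
        refine ⟨φ.trans ψ, C + C', fun x => ?_⟩
        calc ‖(x : Fin d → ℝ) - (ψ (φ x) : Fin d → ℝ)‖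
            ≤ ‖(x : Fin d → ℝ) - (φ x : Fin d → ℝ)‖
              + ‖(φ x : Fin d → ℝ) - (ψ (φ x) : Fin d → ℝ)‖ := norm_sub_le_norm_sub_add_norm_sub _ _ _
          _ ≤ C + C' := add_le_add (h x) (h' (φ x)) }

/-- `BD(X)`: the cardinality of the set of bounded displacement equivalence classes that are
represented by elements of `X`. -/
noncomputable def BD (X : Set (ClosedSubset d)) : Cardinal.{0} :=
  Cardinal.mk ((fun Λ : ClosedSubset d =>
    Quotient.mk (bdSetoid d) (Λ : Set (Fin d → ℝ))) '' X)

/-- `Λ` is uniformly spread: it is bounded displacement equivalent to a (full-rank) lattice. -/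
def IsUniformlySpread (Λ : Set (Fin d → ℝ)) : Prop :=
  ∃ (L : Submodule ℤ (Fin d → ℝ)) (_ : DiscreteTopology L), IsZLattice ℝ L ∧
    BDEquiv Λ (L : Set (Fin d → ℝ))

end DeloneBD

namespace DeloneBD

open Set

variable {d : ℕ}

/-! Bounded displacement equivalence on `X` is the union of the increasing relations `R n`,
"equivalent with displacement at most `n`". Each of them is almost closed: by Hall's theorem the
existence of a matching is tested on finite sets, so it survives Chabauty–Fell limits at the cost of
one unit of displacement (`BDWithin.of_approx`).

Suppose that no closure of an `R n` contains a nonempty open rectangle. Then a Cantor scheme yields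
continuum many points of `X` whose pairs avoid all `R n`, that is, continuum many classes
(`exists_cantor_family`). There are never more, since a Delone set is the range of a sequence.

Otherwise some nonempty open part of `X` consists of sets uniformly equivalent to each other. By
minimality and compactness every element of `X` enters this part under a translation of bounded
length, so all of `X` is uniformly equivalent (`exists_bdWithin_of_open`). In particular the
translates of a single `Λ` are. Its point counts over unions of unit cells are then translation
invariant up to enlarging the union by a fixed box; double counting extracts a density
(`exists_density`), and Hall's condition holds in both directions between `Λ` and a cubic grid of
that density (`exists_bdWithin_grid`). So `Λ` is uniformly spread.

Conversely, translating a lattice amounts to translating it by a bounded vector, so a uniformly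
spread `Λ` is uniformly equivalent to its translates, hence equivalent to every limit of them. By
minimality these limits exhaust `X`, which leaves a single class. -/

/-- There is a bijection `Λ → Γ` moving every point by at most `C`. -/
def BDWithin (C : ℝ) (Λ Γ : Set (Fin d → ℝ)) : Prop :=
  ∃ φ : Λ ≃ Γ, ∀ x : Λ, ‖(x : Fin d → ℝ) - (φ x : Fin d → ℝ)‖ ≤ C

theorem bdEquiv_iff {Λ Γ : Set (Fin d → ℝ)} : BDEquiv Λ Γ ↔ ∃ C, BDWithin C Λ Γ :=
  exists_comm

theorem BDWithin.bdEquiv {C : ℝ} {Λ Γ : Set (Fin d → ℝ)} (h : BDWithin C Λ Γ) : BDEquiv Λ Γ :=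
  bdEquiv_iff.2 ⟨C, h⟩

theorem BDWithin.mono {C C' : ℝ} {Λ Γ : Set (Fin d → ℝ)} (hC : C ≤ C') (h : BDWithin C Λ Γ) :
    BDWithin C' Λ Γ :=
  h.imp fun _ hφ x => (hφ x).trans hC

theorem BDWithin.symm {C : ℝ} {Λ Γ : Set (Fin d → ℝ)} (h : BDWithin C Λ Γ) : BDWithin C Γ Λ := by
  obtain ⟨φ, h⟩ := h
  refine ⟨φ.symm, fun y => ?_⟩
  have := h (φ.symm y)
  rwa [Equiv.apply_symm_apply, norm_sub_rev] at this

theorem BDWithin.trans {C C' : ℝ} {Λ Γ Δ : Set (Fin d → ℝ)} (h : BDWithin C Λ Γ)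
    (h' : BDWithin C' Γ Δ) : BDWithin (C + C') Λ Δ := by
  obtain ⟨φ, h⟩ := h
  obtain ⟨ψ, h'⟩ := h'
  exact ⟨φ.trans ψ, fun x => (norm_sub_le_norm_sub_add_norm_sub _ _ _).trans
    (add_le_add (h x) (h' (φ x)))⟩

/-! ### Bounded matchings and their limits -/

/-- Distinct points of `Λ` are at distance at least `r`. -/
def SeparatedBy (r : ℝ) (Λ : Set (Fin d → ℝ)) : Prop :=
  Λ.Pairwise fun x y => r ≤ dist x y

theorem SeparatedBy.finite_inter_closedBall {r : ℝ} (hr : 0 < r) {Λ : Set (Fin d → ℝ)}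
    (h : SeparatedBy r Λ) (x : Fin d → ℝ) (C : ℝ) : (Λ ∩ Metric.closedBall x C).Finite := by
  obtain ⟨t, ht, hcov⟩ := Metric.totallyBounded_iff.1
    (isCompact_closedBall x C).totallyBounded (r / 2) (by positivity)
  have hch : ∀ y ∈ Λ ∩ Metric.closedBall x C, ∃ z ∈ t, dist y z < r / 2 := fun y hy => by
    simpa using hcov hy.2
  choose! f hft hf using hch
  refine Finite.of_injOn (f := f) (t := t) hft (fun y hy z hz hyz => ?_) ht
  by_contra hne
  have h1 := h hy.1 hz.1 hne
  have h2 := hf y hy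
  have h3 := hf z hz
  rw [← hyz] at h3
  have := dist_triangle_right y z (f y)
  linarith

/-- Hall's marriage theorem for an infinite family: it applies because each point has only finitely
many candidates within distance `C`. -/
theorem exists_injective_of_hall {Λ Γ : Set (Fin d → ℝ)} {C : ℝ}
    (hfin : ∀ x, (Γ ∩ Metric.closedBall x C).Finite)
    (h : ∀ F : Finset (Fin d → ℝ), (F : Set (Fin d → ℝ)) ⊆ Λ → ∃ G : Finset (Fin d → ℝ),
      (∀ y ∈ G, y ∈ Γ ∧ ∃ x ∈ F, ‖x - y‖ ≤ C) ∧ F.card ≤ G.card) :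
    ∃ f : Λ → Γ, Function.Injective f ∧
      ∀ x : Λ, ‖(x : Fin d → ℝ) - (f x : Fin d → ℝ)‖ ≤ C := by
  classical
  have hmem : ∀ x y, y ∈ (hfin x).toFinset ↔ y ∈ Γ ∧ ‖x - y‖ ≤ C := fun x y => by
    rw [Set.Finite.mem_toFinset, mem_inter_iff, Metric.mem_closedBall, dist_comm, dist_eq_norm]
  obtain ⟨f, hf, hft⟩ := (Finset.all_card_le_biUnion_card_iff_exists_injective
    (fun x : Λ => (hfin x).toFinset)).1 fun s => by
      obtain ⟨G, hG, hcard⟩ := h (s.map (Function.Embedding.subtype _)) (by simp)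
      rw [Finset.card_map] at hcard
      refine hcard.trans (Finset.card_le_card fun y hy => ?_)
      obtain ⟨hyΓ, x, hx, hxy⟩ := hG y hy
      obtain ⟨x, hxs, rfl⟩ := Finset.mem_map.1 hx
      exact Finset.mem_biUnion.2 ⟨x, hxs, (hmem _ _).2 ⟨hyΓ, hxy⟩⟩
  refine ⟨fun x => ⟨f x, ((hmem _ _).1 (hft x)).1⟩, fun x y hxy => hf (congrArg Subtype.val hxy),
    fun x => ((hmem _ _).1 (hft x)).2⟩

/-- The Schröder–Bernstein bijection pairs points only along `f` or along `g` reversed, so it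
inherits their bound. -/
theorem BDWithin.of_injective {Λ Γ : Set (Fin d → ℝ)} {C : ℝ} {f : Λ → Γ} {g : Γ → Λ}
    (hf : Function.Injective f) (hg : Function.Injective g)
    (hfC : ∀ x : Λ, ‖(x : Fin d → ℝ) - (f x : Fin d → ℝ)‖ ≤ C)
    (hgC : ∀ y : Γ, ‖(y : Fin d → ℝ) - (g y : Fin d → ℝ)‖ ≤ C) : BDWithin C Λ Γ := by
  obtain ⟨h, hb, hR⟩ := Function.Embedding.schroeder_bernstein_of_rel hf hg
    (fun x y => ‖(x : Fin d → ℝ) - (y : Fin d → ℝ)‖ ≤ C) hfC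
    fun y => by rw [norm_sub_rev]; exact hgC y
  exact ⟨Equiv.ofBijective h hb, hR⟩

/-- Distance at most `ε` to a set that need not be closed may not be attained; doubling the radius
provides an actual point. -/
theorem CFClose.exists_dist_le {Λ Γ : Set (Fin d → ℝ)} {ε : ℝ} (hε : 0 < ε) (h : CFClose Λ Γ ε)
    {x : Fin d → ℝ} (hx : x ∈ Λ) (hn : ‖x‖ < 1 / ε) : ∃ y ∈ Γ, dist x y ≤ 2 * ε := by
  have h1 : x ∈ Metric.thickening (2 * ε) Γ :=
    Metric.cthickening_subset_thickening' (by linarith) (by linarith) _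
      (h.1 ⟨hx, mem_ball_zero_iff.2 hn⟩)
  obtain ⟨y, hy, hxy⟩ := Metric.mem_thickening_iff.1 h1
  exact ⟨y, hy, hxy.le⟩

/-- Hall's condition involves one finite `F` at a time, so a single good approximation suffices:
pass from `F` to `Λ'`, match into `Γ'`, and return to `Γ`. Separation keeps this composite
injective. -/
theorem exists_injective_of_approx {Λ Γ : Set (Fin d → ℝ)} {C r : ℝ} (hr : 0 < r)
    (hΛ : SeparatedBy r Λ) (hΓ : SeparatedBy r Γ)
    (h : ∀ ε > 0, ∃ Λ' Γ' : Set (Fin d → ℝ), CFClose Λ Λ' ε ∧ CFClose Γ Γ' ε ∧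
      SeparatedBy r Γ' ∧ BDWithin C Λ' Γ') :
    ∃ f : Λ → Γ, Function.Injective f ∧
      ∀ x : Λ, ‖(x : Fin d → ℝ) - (f x : Fin d → ℝ)‖ ≤ C + 1 := by
  refine exists_injective_of_hall (fun x => hΓ.finite_inter_closedBall hr x _) fun F hF => ?_
  classical
  obtain ⟨M, hM⟩ : ∃ M : ℝ, ∀ x ∈ F, ‖x‖ ≤ M := by
    obtain ⟨M, hM⟩ := (F.image fun x => ‖x‖).bddAbove
    exact ⟨M, fun x hx => hM (by simpa using ⟨x, hx, rfl⟩)⟩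
  have hpos : 0 < |M| + |C| + 2 := by positivity
  -- The first bound keeps `F` and its matched points in the ball of radius `1 / ε`; the second
  -- makes the error `4 * ε` at most `1`; the third makes it less than `r`.
  set ε : ℝ := min (1 / (|M| + |C| + 2)) (min (1 / 4) (r / 5)) with hεdef
  have hε : 0 < ε := lt_min (by positivity) (lt_min (by norm_num) (by positivity))
  have hε1 : ε ≤ 1 / (|M| + |C| + 2) := min_le_left _ _
  have hε2 : ε ≤ 1 / 4 := (min_le_right _ _).trans (min_le_left _ _)
  have hε3 : ε ≤ r / 5 := (min_le_right _ _).trans (min_le_right _ _)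
  have hε4 : |M| + |C| + 2 ≤ 1 / ε := (le_one_div hε hpos).1 hε1
  obtain ⟨Λ', Γ', hΛΛ', hΓΓ', hsep, φ, hφ⟩ := h ε hε
  have hch : ∀ x ∈ F, ∃ y ∈ Γ, ∃ x' : Λ', dist x x' ≤ 2 * ε ∧ dist (φ x' : Fin d → ℝ) y ≤ 2 * ε ∧
      ‖x - y‖ ≤ C + 1 := by
    intro x hx
    have hxM := (hM x hx).trans (le_abs_self M)
    obtain ⟨x', hx', hxx'⟩ := hΛΛ'.exists_dist_le hε (hF hx)
      (by have := abs_nonneg C; linarith)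
    have h1 := hφ ⟨x', hx'⟩
    have h2 : dist x (φ ⟨x', hx'⟩ : Fin d → ℝ) ≤ 2 * ε + C := by
      refine (dist_triangle x x' _).trans (add_le_add hxx' ?_)
      rwa [dist_eq_norm]
    have h3 : ‖(φ ⟨x', hx'⟩ : Fin d → ℝ)‖ < 1 / ε := by
      have := norm_le_norm_add_norm_sub' (φ ⟨x', hx'⟩ : Fin d → ℝ) x
      rw [norm_sub_rev, ← dist_eq_norm] at this
      rw [dist_comm] at h2
      rw [dist_comm] at this
      have := le_abs_self C
      linarith
    obtain ⟨y, hy, hyy⟩ := hΓΓ'.symm.exists_dist_le hε (φ ⟨x', hx'⟩).2 h3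
    refine ⟨y, hy, ⟨x', hx'⟩, hxx', hyy, ?_⟩
    rw [← dist_eq_norm]
    refine (dist_triangle x (φ ⟨x', hx'⟩ : Fin d → ℝ) y).trans ?_
    linarith
  choose! g hgΓ x' hxx' hgy hgC using hch
  refine ⟨F.image g, fun y hy => ?_, ?_⟩
  · obtain ⟨x, hx, rfl⟩ := Finset.mem_image.1 hy
    exact ⟨hgΓ x hx, x, hx, hgC x hx⟩
  · rw [Finset.card_image_of_injOn]
    intro x hx z hz hxz
    have e1 : x' x hx = x' z hz := by
      by_contra hne
      have hne' : (φ (x' x hx) : Fin d → ℝ) ≠ φ (x' z hz) := fun h => hne (φ.injective (Subtype.ext h))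
      have h1 := hsep (φ (x' x hx)).2 (φ (x' z hz)).2 hne'
      have h2 := hgy x hx
      have h3 := hgy z hz
      have hxz' : g x = g z := hxz
      rw [← hxz'] at h3
      have := dist_triangle_right (φ (x' x hx) : Fin d → ℝ) (φ (x' z hz)) (g x)
      linarith
    by_contra hne
    have h1 := hΛ (hF hx) (hF hz) hne
    have h2 := hxx' x hx
    have h3 := hxx' z hz
    rw [← e1] at h3
    have := dist_triangle_right x z (x' x hx : Fin d → ℝ)
    linarith

theorem BDWithin.of_approx {Λ Γ : Set (Fin d → ℝ)} {C r : ℝ} (hr : 0 < r)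
    (hΛ : SeparatedBy r Λ) (hΓ : SeparatedBy r Γ)
    (h : ∀ ε > 0, ∃ Λ' Γ' : Set (Fin d → ℝ), CFClose Λ Λ' ε ∧ CFClose Γ Γ' ε ∧
      SeparatedBy r Λ' ∧ SeparatedBy r Γ' ∧ BDWithin C Λ' Γ') : BDWithin (C + 1) Λ Γ := by
  obtain ⟨f, hf, hfC⟩ := exists_injective_of_approx (C := C) hr hΛ hΓ fun ε hε => by
    obtain ⟨Λ', Γ', h1, h2, h3, h4, h5⟩ := h ε hε
    exact ⟨Λ', Γ', h1, h2, h4, h5⟩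
  obtain ⟨g, hg, hgC⟩ := exists_injective_of_approx (C := C) hr hΓ hΛ fun ε hε => by
    obtain ⟨Λ', Γ', h1, h2, h3, h4, h5⟩ := h ε hε
    exact ⟨Γ', Λ', h2, h1, h3, h5.symm⟩
  exact .of_injective hf hg hfC hgC

/-! ### Separation and translations in the Chabauty–Fell topology -/

theorem cfClose_of_dist_lt {Λ Γ : ClosedSubset d} {ε : ℝ} (hε : 0 < ε)
    (h : dist Λ Γ < min ε 1) :
    CFClose (Λ : Set (Fin d → ℝ)) (Γ : Set (Fin d → ℝ)) ε :=
  (cfClose_of_cfDist_lt (ε := min ε 1) h (min_le_right _ _)).mono (lt_min hε one_pos)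
    (min_le_left _ _)

theorem bdWithin_vadd (v : Fin d → ℝ) (Λ : ClosedSubset d) :
    BDWithin ‖v‖ (Λ : Set (Fin d → ℝ)) ((v +ᵥ Λ : ClosedSubset d) : Set (Fin d → ℝ)) :=
  ⟨Equiv.Set.image _ _ (add_right_injective v), fun x => by
    change ‖(x : Fin d → ℝ) - (v + x)‖ ≤ ‖v‖
    simp⟩

theorem SeparatedBy.vadd {r : ℝ} {Λ : ClosedSubset d} (h : SeparatedBy r (Λ : Set (Fin d → ℝ)))
    (v : Fin d → ℝ) : SeparatedBy r ((v +ᵥ Λ : ClosedSubset d) : Set (Fin d → ℝ)) := by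
  rintro _ ⟨x, hx, rfl⟩ _ ⟨y, hy, rfl⟩ hne
  simpa using h hx hy fun hxy => hne (by rw [hxy])

theorem IsDelone.exists_separatedBy {Λ : Set (Fin d → ℝ)} (h : IsDelone Λ) :
    ∃ r > 0, SeparatedBy r Λ := by
  obtain ⟨D, rfl⟩ := h
  exact ⟨D.packingRadius, D.packingRadius_pos, fun x hx y hy hne =>
    (D.packingRadius_lt_dist_of_mem_ne hx hy hne).le⟩

theorem IsDelone.nonempty {Λ : Set (Fin d → ℝ)} (h : IsDelone Λ) : Λ.Nonempty := by
  obtain ⟨D, rfl⟩ := h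
  exact D.nonempty

theorem SeparatedBy.of_mem_closure {r : ℝ} {S : Set (ClosedSubset d)}
    (h : ∀ Λ ∈ S, SeparatedBy r (Λ : Set (Fin d → ℝ))) {Γ : ClosedSubset d} (hΓ : Γ ∈ closure S) :
    SeparatedBy r (Γ : Set (Fin d → ℝ)) := by
  intro x hx y hy hne
  refine le_of_forall_pos_le_add fun η hη => ?_
  have hxy : 0 < dist x y := dist_pos.2 hne
  set M : ℝ := ‖x‖ + ‖y‖ + 1
  have hM : 0 < M := by positivity
  -- The approximants of `x` and `y` are distinct because `4 * ε < dist x y`, and passing to them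
  -- costs at most `4 * ε ≤ η`.
  set ε : ℝ := min (1 / M) (min (dist x y / 5) (η / 4))
  have hε : 0 < ε := lt_min (by positivity) (lt_min (by positivity) (by positivity))
  have hε1 : M ≤ 1 / ε := (le_one_div hε hM).1 (min_le_left _ _)
  have hε2 : ε ≤ dist x y / 5 := (min_le_right _ _).trans (min_le_left _ _)
  have hε3 : ε ≤ η / 4 := (min_le_right _ _).trans (min_le_right _ _)
  obtain ⟨Λ, hΛ, hd⟩ := Metric.mem_closure_iff.1 hΓ (min ε 1) (lt_min hε one_pos)
  have hc := cfClose_of_dist_lt hε hd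
  obtain ⟨x', hx', hxx'⟩ := hc.exists_dist_le hε hx
    (lt_of_lt_of_le (by simp only [M]; linarith [norm_nonneg y]) hε1)
  obtain ⟨y', hy', hyy'⟩ := hc.exists_dist_le hε hy
    (lt_of_lt_of_le (by simp only [M]; linarith [norm_nonneg x]) hε1)
  have hne' : x' ≠ y' := by
    rintro rfl
    have := dist_triangle_right x y x'
    linarith
  have h1 := h Λ hΛ hx' hy' hne'
  have h2 := dist_triangle4 x' x y y'
  rw [dist_comm x' x] at h2
  linarith

theorem continuous_vadd_closedSubset (v : Fin d → ℝ) :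
    Continuous fun Λ : ClosedSubset d => v +ᵥ Λ := by
  have key : ∀ (Λ Γ : ClosedSubset d) (ε δ : ℝ), 0 < δ → δ ≤ ε → 1 / ε + ‖v‖ ≤ 1 / δ →
      CFClose (Λ : Set (Fin d → ℝ)) (Γ : Set (Fin d → ℝ)) δ →
      ((v +ᵥ Λ : ClosedSubset d) : Set (Fin d → ℝ)) ∩ Metric.ball 0 (1 / ε) ⊆
        Metric.cthickening (2 * ε) ((v +ᵥ Γ : ClosedSubset d) : Set (Fin d → ℝ)) := by
    rintro Λ Γ ε δ hδ hδε hδv hc _ ⟨⟨x, hx, rfl⟩, hxb⟩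
    have hxn : ‖x‖ < 1 / δ := by
      rw [mem_ball_zero_iff] at hxb
      have : ‖x‖ ≤ ‖v + x‖ + ‖v‖ := by
        simpa using norm_sub_le (v + x) v
      change ‖v + x‖ < _ at hxb
      linarith
    obtain ⟨y, hy, hxy⟩ := hc.exists_dist_le hδ hx hxn
    refine Metric.mem_cthickening_of_dist_le _ (v + y) _ _ ⟨y, hy, rfl⟩ ?_
    simp only [dist_add_left]
    linarith
  refine Metric.continuous_iff.2 fun Γ ε hε => ?_
  set η : ℝ := ε / 4
  have hη : 0 < η := by positivity
  have hpos : 0 < 1 / η + ‖v‖ := by positivity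
  -- Translation by `v` shifts the observed window by `‖v‖`, so closeness is required on a window
  -- larger by that amount.
  set δ : ℝ := min η (1 / (1 / η + ‖v‖))
  have hδ : 0 < δ := lt_min hη (by positivity)
  have hδ1 : 1 / η + ‖v‖ ≤ 1 / δ := (le_one_div hδ hpos).1 (min_le_right _ _)
  refine ⟨min δ 1, lt_min hδ one_pos, fun Λ hΛ => ?_⟩
  have hc := cfClose_of_dist_lt hδ hΛ
  have hb : Metric.ball (0 : Fin d → ℝ) (1 / (2 * η)) ⊆ Metric.ball 0 (1 / η) :=
    Metric.ball_subset_ball (one_div_le_one_div_of_le hη (by linarith))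
  have hc' : cfDist ((v +ᵥ Λ : ClosedSubset d) : Set (Fin d → ℝ)) (v +ᵥ Γ : ClosedSubset d) ≤
      2 * η := cfDist_le (by positivity)
    ⟨(inter_subset_inter_right _ hb).trans (key Λ Γ η δ hδ (min_le_left _ _) hδ1 hc),
      (inter_subset_inter_right _ hb).trans (key Γ Λ η δ hδ (min_le_left _ _) hδ1 hc.symm)⟩
  refine lt_of_le_of_lt hc' ?_
  simp only [η]
  linarith

/-! ### Cantor schemes avoiding sparse relations -/

section CantorFamily

variable {Y : Type*} [TopologicalSpace Y]

theorem exists_open_closure_subset [RegularSpace Y] {U : Set Y} (hU : IsOpen U)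
    (hne : U.Nonempty) : ∃ V, IsOpen V ∧ V.Nonempty ∧ closure V ⊆ U := by
  obtain ⟨x, hx⟩ := hne
  obtain ⟨K, hK, hKc, hKU⟩ := exists_mem_nhds_isClosed_subset (hU.mem_nhds hx)
  exact ⟨interior K, isOpen_interior, ⟨x, mem_interior_iff_mem_nhds.2 hK⟩,
    (closure_minimal interior_subset hKc).trans hKU⟩

/-- A closed relation containing no nonempty open rectangle. -/
def IsSparse (W : Set (Y × Y)) : Prop :=
  IsClosed W ∧ ∀ U V : Set Y, IsOpen U → IsOpen V → U.Nonempty → V.Nonempty → ¬U ×ˢ V ⊆ W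

theorem IsSparse.exists_open_prod_subset_compl {W : Set (Y × Y)} (hW : IsSparse W) {U V : Set Y}
    (hU : IsOpen U) (hV : IsOpen V) (hUne : U.Nonempty) (hVne : V.Nonempty) :
    ∃ A B : Set Y, IsOpen A ∧ IsOpen B ∧ A.Nonempty ∧ B.Nonempty ∧ A ⊆ U ∧ B ⊆ V ∧
      ∀ x ∈ A, ∀ y ∈ B, (x, y) ∉ W := by
  obtain ⟨⟨a, b⟩, hab, habW⟩ := not_subset.1 (hW.2 U V hU hV hUne hVne)
  obtain ⟨A, B, hA, hB, ha, hb, hAB⟩ := isOpen_prod_iff.1 ((hU.prod hV).inter hW.1.isOpen_compl)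
    a b ⟨hab, habW⟩
  refine ⟨A, B, hA, hB, ⟨a, ha⟩, ⟨b, hb⟩, fun x hx => (hAB (mk_mem_prod hx hb)).1.1,
    fun y hy => (hAB (mk_mem_prod ha hy)).1.2, fun x hx y hy => (hAB (mk_mem_prod hx hy)).2⟩

/-- Pairs are treated one at a time; shrinking the open sets further preserves the avoidance already
achieved. -/
theorem IsSparse.exists_open_family {ι : Type*} {W : Set (Y × Y)}
    (hW : IsSparse W) {U : ι → Set Y} (hU : ∀ i, IsOpen (U i))
    (hne : ∀ i, (U i).Nonempty) (S : Finset (ι × ι)) :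
    ∃ V : ι → Set Y, (∀ i, IsOpen (V i)) ∧ (∀ i, (V i).Nonempty) ∧ (∀ i, V i ⊆ U i) ∧
      ∀ p ∈ S, p.1 ≠ p.2 → ∀ x ∈ V p.1, ∀ y ∈ V p.2, (x, y) ∉ W := by
  classical
  induction S using Finset.induction_on with
  | empty => exact ⟨U, hU, hne, fun _ => Subset.rfl, by simp⟩
  | insert p S _ ih =>
    obtain ⟨V, hVo, hVne, hVU, hV⟩ := ih
    by_cases hp : p.1 = p.2
    · refine ⟨V, hVo, hVne, hVU, fun q hq hq' => ?_⟩
      rcases Finset.mem_insert.1 hq with rfl | hq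
      · exact absurd hp hq'
      · exact hV q hq hq'
    obtain ⟨A, B, hA, hB, hAne, hBne, hAV, hBV, hAB⟩ :=
      hW.exists_open_prod_subset_compl (hVo p.1) (hVo p.2) (hVne _) (hVne _)
    set V' := Function.update (Function.update V p.1 A) p.2 B with hV'def
    have h1 : V' p.1 = A := by
      rw [hV'def, Function.update_of_ne hp, Function.update_self]
    have h2 : V' p.2 = B := by rw [hV'def, Function.update_self]
    have h3 : ∀ i, i ≠ p.1 → i ≠ p.2 → V' i = V i := fun i hi hi' => by
      rw [hV'def, Function.update_of_ne hi', Function.update_of_ne hi]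
    have hV' : ∀ i, IsOpen (V' i) ∧ (V' i).Nonempty ∧ V' i ⊆ V i := by
      intro i
      by_cases hi : i = p.1
      · rw [hi, h1]; exact ⟨hA, hAne, hAV⟩
      by_cases hi' : i = p.2
      · rw [hi', h2]; exact ⟨hB, hBne, hBV⟩
      · rw [h3 i hi hi']; exact ⟨hVo i, hVne i, Subset.rfl⟩
    refine ⟨V', fun i => (hV' i).1, fun i => (hV' i).2.1, fun i => (hV' i).2.2.trans (hVU i),
      fun q hq hq' => ?_⟩
    rcases Finset.mem_insert.1 hq with rfl | hq
    · rw [h1, h2]; exact hAB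
    · exact fun x hx y hy => hV q hq hq' x ((hV' _).2.2 hx) y ((hV' _).2.2 hy)

theorem IsSparse.exists_cantor_step [RegularSpace Y] {W : Set (Y × Y)} (hW : IsSparse W) {n : ℕ}
    {U : (Fin n → Bool) → Set Y} (hU : ∀ s, IsOpen (U s) ∧ (U s).Nonempty) :
    ∃ V : (Fin (n + 1) → Bool) → Set Y, (∀ s, IsOpen (V s) ∧ (V s).Nonempty) ∧
      (∀ s, closure (V s) ⊆ U (Fin.init s)) ∧
      ∀ s t, s ≠ t → ∀ x ∈ V s, ∀ y ∈ V t, (x, y) ∉ W := by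
  obtain ⟨V, hVo, hVne, hVU, hV⟩ := hW.exists_open_family
    (U := fun s : Fin (n + 1) → Bool => U (Fin.init s)) (fun s => (hU _).1) (fun s => (hU _).2)
    Finset.univ
  choose V' hV'o hV'ne hV'V using fun s => exists_open_closure_subset (hVo s) (hVne s)
  exact ⟨V', fun s => ⟨hV'o s, hV'ne s⟩, fun s => (hV'V s).trans (hVU s), fun s t hst x hx y hy =>
    hV (s, t) (Finset.mem_univ _) hst x (hV'V s (subset_closure hx)) y
      (hV'V t (subset_closure hy))⟩

/-- In a nonempty compact regular space, an increasing sequence of sparse closed relations is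
avoided by all pairs of distinct points of a family indexed by the Cantor space. -/
theorem exists_cantor_family [RegularSpace Y] [CompactSpace Y] [Nonempty Y]
    {W : ℕ → Set (Y × Y)} (hW : ∀ n, IsSparse (W n)) (hmono : Monotone W) :
    ∃ f : (ℕ → Bool) → Y, ∀ a b, a ≠ b → ∀ n, (f a, f b) ∉ W n := by
  let T : ℕ → Type _ := fun n =>
    {U : (Fin n → Bool) → Set Y // ∀ s, IsOpen (U s) ∧ (U s).Nonempty}
  have hstep : ∀ (n : ℕ) (U : T n), ∃ V : T (n + 1), (∀ s, closure (V.1 s) ⊆ U.1 (Fin.init s)) ∧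
      ∀ s t, s ≠ t → ∀ x ∈ V.1 s, ∀ y ∈ V.1 t, (x, y) ∉ W n := fun n U => by
    obtain ⟨V, hV, h⟩ := (hW n).exists_cantor_step U.2
    exact ⟨⟨V, hV⟩, h⟩
  choose next hnext hnextW using hstep
  let U : ∀ n, T n := fun n =>
    Nat.rec ⟨fun _ => univ, fun _ => ⟨isOpen_univ, univ_nonempty⟩⟩ next n
  have hUs : ∀ n, U (n + 1) = next n (U n) := fun n => rfl
  have hex : ∀ a : ℕ → Bool, (⋂ n, closure ((U n).1 fun i => a i)).Nonempty := by
    intro a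
    refine IsCompact.nonempty_iInter_of_sequence_nonempty_isCompact_isClosed _ (fun n => ?_)
      (fun n => ((U n).2 _).2.closure) isClosed_closure.isCompact fun n => isClosed_closure
    rw [hUs]
    exact (hnext n (U n) fun i => a i).trans subset_closure
  choose f hf using hex
  have hf' : ∀ a n, f a ∈ (U n).1 fun i => a i := fun a n => by
    have := mem_iInter.1 (hf a) (n + 1)
    rw [hUs] at this
    exact hnext n (U n) _ this
  refine ⟨f, fun a b hab n hn => ?_⟩
  obtain ⟨k, hk⟩ := Function.ne_iff.1 hab
  have h1 := hf' a (max n k + 1)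
  have h2 := hf' b (max n k + 1)
  -- Level `max n k + 1` sees coordinate `k`, where `a` and `b` differ, and its sets avoid `W (max n
  -- k)`, which contains `W n`.
  rw [hUs] at h1 h2
  refine hnextW (max n k) _ _ _ (fun h => hk ?_) _ h1 _ h2 (hmono (le_max_left n k) hn)
  exact congrFun h ⟨k, Nat.lt_succ_of_le (le_max_right n k)⟩

end CantorFamily

/-! ### Density of an almost invariant counting function -/

-- Both sides are compared with the sum of `c (a + b)` over `a ∈ A + I` and `b ∈ B`, evaluated in
-- the two orders of summation.
open scoped Pointwise in
theorem card_mul_sum_le {G : Type*} [AddCommGroup G] [DecidableEq G] (c : G → ℕ) (I : Finset G)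
    (h : ∀ (A : Finset G) (v w : G), ∑ a ∈ A, c (a + v) ≤ ∑ a ∈ A + I, c (a + w))
    (A B : Finset G) : B.card * ∑ a ∈ A, c a ≤ (A + I).card * ∑ b ∈ B + I, c b := by
  calc B.card * ∑ a ∈ A, c a = ∑ _b ∈ B, ∑ a ∈ A, c (a + 0) := by simp
    _ ≤ ∑ b ∈ B, ∑ a ∈ A + I, c (a + b) := Finset.sum_le_sum fun b _ => h A 0 b
    _ = ∑ a ∈ A + I, ∑ b ∈ B, c (b + a) := by
        rw [Finset.sum_comm]
        simp only [add_comm]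
    _ ≤ ∑ _a ∈ A + I, ∑ b ∈ B + I, c (b + 0) := Finset.sum_le_sum fun a _ => h B a 0
    _ = (A + I).card * ∑ b ∈ B + I, c b := by simp

open scoped Pointwise in
/-- A function whose sums over finite sets are, up to enlarging the set by `I`, almost translation
invariant has a density. -/
theorem exists_density {G : Type*} [AddCommGroup G] [DecidableEq G] (c : G → ℕ) (I : Finset G)
    (h : ∀ (A : Finset G) (v w : G), ∑ a ∈ A, c (a + v) ≤ ∑ a ∈ A + I, c (a + w)) :
    ∃ ρ : ℝ, ∀ A : Finset G, (∑ a ∈ A, c a : ℕ) ≤ ρ * (A + I).card ∧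
      ρ * A.card ≤ (∑ a ∈ A + I, c a : ℕ) := by
  -- By `card_mul_sum_le` every lower quotient `c(A) / |A + I|` is at most every upper quotient `c(B
  -- + I) / |B|`; the infimum of the latter separates the two families.
  let q : {B : Finset G // B.Nonempty} → ℝ := fun B => (∑ b ∈ B.1 + I, c b : ℕ) / (B.1.card : ℝ)
  have hbdd : BddBelow (range q) := ⟨0, by rintro _ ⟨B, rfl⟩; positivity⟩
  have : Nonempty {B : Finset G // B.Nonempty} := ⟨⟨{0}, by simp⟩⟩
  refine ⟨⨅ B, q B, fun A => ⟨?_, ?_⟩⟩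
  · rcases A.eq_empty_or_nonempty with rfl | hA
    · simp
    have hAI : (A + I).card = 0 → (∑ a ∈ A, c a : ℕ) = 0 := fun h0 => by
      have h1 := h A 0 0
      rw [Finset.card_eq_zero.1 h0] at h1
      simpa using h1
    rcases Nat.eq_zero_or_pos (A + I).card with h0 | hpos
    · rw [hAI h0, h0]; simp
    have hpos' : (0 : ℝ) < (A + I).card := by exact_mod_cast hpos
    rw [← div_le_iff₀ hpos']
    refine le_ciInf fun B => ?_
    have hB : (0 : ℝ) < B.1.card := by exact_mod_cast B.2.card_pos
    rw [div_le_div_iff₀ hpos' hB]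
    have := card_mul_sum_le c I h A B.1
    rw [mul_comm, mul_comm (A + I).card] at this
    exact_mod_cast this
  · rcases A.eq_empty_or_nonempty with rfl | hA
    · simp
    have hpos : (0 : ℝ) < A.card := by exact_mod_cast hA.card_pos
    rw [← le_div_iff₀ hpos]
    exact ciInf_le hbdd ⟨A, hA⟩

/-! ### Cubes, grids and point counts in unit cells -/

/-- The half-open cube of side `s` with lower corner `x`. -/
def cube (s : ℝ) (x : Fin d → ℝ) : Set (Fin d → ℝ) :=
  univ.pi fun i => Ico (x i) (x i + s)

theorem mem_cube {s : ℝ} {x p : Fin d → ℝ} : p ∈ cube s x ↔ ∀ i, x i ≤ p i ∧ p i < x i + s := by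
  simp [cube]

theorem volume_cube (s : ℝ) (x : Fin d → ℝ) :
    MeasureTheory.volume (cube s x) = ENNReal.ofReal s ^ d := by
  simp [cube, Real.volume_pi_Ico]

theorem measurableSet_cube (s : ℝ) (x : Fin d → ℝ) : MeasurableSet (cube s x) :=
  MeasurableSet.univ_pi fun _ => measurableSet_Ico

/-- Compare volumes: additive on the disjoint cubes, subadditive on the covering ones. -/
theorem card_mul_pow_le_of_cubes {s t : ℝ} (hs : 0 ≤ s) (ht : 0 ≤ t) {F G : Finset (Fin d → ℝ)}
    (hF : (F : Set (Fin d → ℝ)).PairwiseDisjoint (cube s))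
    (hcov : ∀ x ∈ F, ∀ p ∈ cube s x, ∃ y ∈ G, p ∈ cube t y) :
    F.card * s ^ d ≤ G.card * t ^ d := by
  have h1 : MeasureTheory.volume (⋃ x ∈ F, cube s x) ≤
      MeasureTheory.volume (⋃ y ∈ G, cube t y) :=
    MeasureTheory.measure_mono (iUnion₂_subset fun x hx p hp => by
      simpa using hcov x hx p hp)
  rw [MeasureTheory.measure_biUnion_finset hF fun x _ => measurableSet_cube s x] at h1
  have h2 := h1.trans (MeasureTheory.measure_biUnion_finset_le G (cube t))
  simp only [volume_cube, Finset.sum_const, nsmul_eq_mul] at h2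
  have h3 : ENNReal.ofReal (F.card * s ^ d) ≤ ENNReal.ofReal (G.card * t ^ d) := by
    rwa [ENNReal.ofReal_mul (by positivity), ENNReal.ofReal_mul (by positivity),
      ENNReal.ofReal_pow hs, ENNReal.ofReal_pow ht, ENNReal.ofReal_natCast, ENNReal.ofReal_natCast]
  exact (ENNReal.ofReal_le_ofReal_iff (by positivity)).1 h3

/-- The point `s • u` of the grid `s ℤ^d`. -/
noncomputable def gridPoint (s : ℝ) (u : Fin d → ℤ) : Fin d → ℝ := fun i => s * u i

/-- The coordinatewise integer part. -/
noncomputable def floorVec (x : Fin d → ℝ) : Fin d → ℤ := fun i => ⌊x i⌋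

theorem abs_apply_sub_le {x y : Fin d → ℝ} {C : ℝ} (h : ‖x - y‖ ≤ C) (i : Fin d) :
    |x i - y i| ≤ C :=
  (norm_le_pi_norm (x - y) i).trans h

theorem mem_cube_gridPoint {s : ℝ} (hs : 0 < s) (p : Fin d → ℝ) :
    p ∈ cube s (gridPoint s fun i => ⌊p i / s⌋) := by
  refine mem_cube.2 fun i => ?_
  have h1 := Int.floor_le (p i / s)
  have h2 := Int.lt_floor_add_one (p i / s)
  rw [le_div_iff₀ hs] at h1
  rw [div_lt_iff₀ hs] at h2
  simp only [gridPoint]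
  constructor <;> linarith

theorem eq_of_mem_cube_gridPoint {s : ℝ} (hs : 0 < s) {p : Fin d → ℝ} {u : Fin d → ℤ}
    (h : p ∈ cube s (gridPoint s u)) : u = fun i => ⌊p i / s⌋ := by
  funext i
  obtain ⟨h1, h2⟩ := mem_cube.1 h i
  simp only [gridPoint] at h1 h2
  refine (Int.floor_eq_iff.2 ⟨?_, ?_⟩).symm
  · rw [le_div_iff₀ hs]; linarith
  · rw [div_lt_iff₀ hs]; linarith

theorem pairwiseDisjoint_cube_grid {s : ℝ} (hs : 0 < s) :
    (range (gridPoint (d := d) s)).PairwiseDisjoint (cube s) := by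
  rintro _ ⟨u, rfl⟩ _ ⟨v, rfl⟩ hne
  refine Set.disjoint_left.2 fun p hp hq => hne ?_
  rw [eq_of_mem_cube_gridPoint hs hp, eq_of_mem_cube_gridPoint hs hq]

theorem separatedBy_grid {s : ℝ} (hs : 0 < s) : SeparatedBy s (range (gridPoint (d := d) s)) := by
  rintro _ ⟨u, rfl⟩ _ ⟨v, rfl⟩ hne
  obtain ⟨i, hi⟩ := Function.ne_iff.1 fun h : u = v => hne (by rw [h])
  refine le_trans ?_ (dist_le_pi_dist _ _ i)
  have h1 : (1 : ℝ) ≤ |(u i : ℝ) - v i| := by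
    exact_mod_cast Int.one_le_abs (sub_ne_zero.2 hi)
  rw [Real.dist_eq, gridPoint, gridPoint, ← mul_sub, abs_mul, abs_of_pos hs]
  nlinarith

theorem BDWithin.exists_injOn {C : ℝ} {Λ Γ : Set (Fin d → ℝ)} (h : BDWithin C Λ Γ) :
    ∃ f : (Fin d → ℝ) → (Fin d → ℝ), MapsTo f Λ Γ ∧ InjOn f Λ ∧ ∀ x ∈ Λ, ‖x - f x‖ ≤ C := by
  classical
  obtain ⟨φ, hφ⟩ := h
  refine ⟨fun x => if hx : x ∈ Λ then φ ⟨x, hx⟩ else 0, fun x hx => ?_, fun x hx y hy hxy => ?_,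
    fun x hx => ?_⟩
  · simp [hx]
  · simp only [hx, hy, dif_pos] at hxy
    simpa using φ.injective (Subtype.ext hxy)
  · simpa [hx] using hφ ⟨x, hx⟩

/-- The box `{-k, …, k}^d`. -/
noncomputable def intBox (d k : ℕ) : Finset (Fin d → ℤ) :=
  Finset.Icc (fun _ => -(k : ℤ)) fun _ => (k : ℤ)

theorem mem_intBox {k : ℕ} {u : Fin d → ℤ} : u ∈ intBox d k ↔ ∀ i, |u i| ≤ k := by
  simp only [intBox, Finset.mem_Icc, Pi.le_def, abs_le, forall_and]

theorem floorVec_sub_mem_intBox {x y : Fin d → ℝ} {C : ℝ} (h : ‖x - y‖ ≤ C) :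
    floorVec y - floorVec x ∈ intBox d (⌈C⌉₊ + 1) := by
  refine mem_intBox.2 fun i => ?_
  have h1 := abs_le.1 (abs_apply_sub_le h i)
  have h2 := Nat.le_ceil C
  have h3 := Int.floor_le (x i)
  have h4 := Int.lt_floor_add_one (x i)
  have h5 := Int.floor_le (y i)
  have h6 := Int.lt_floor_add_one (y i)
  have h7 : (((⌊y i⌋ - ⌊x i⌋ : ℤ)) : ℝ) < ((⌈C⌉₊ + 1 : ℕ) : ℤ) + 1 := by push_cast; linarith
  have h8 : (-((⌈C⌉₊ + 1 : ℕ) : ℤ) - 1 : ℝ) < ((⌊y i⌋ - ⌊x i⌋ : ℤ)) := by push_cast; linarith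
  simp only [floorVec, Pi.sub_apply, abs_le]
  constructor
  · have : (-((⌈C⌉₊ + 1 : ℕ) : ℤ) - 1 : ℤ) < (⌊y i⌋ - ⌊x i⌋ : ℤ) := by exact_mod_cast h8
    omega
  · have : (⌊y i⌋ - ⌊x i⌋ : ℤ) < ((⌈C⌉₊ + 1 : ℕ) : ℤ) + 1 := by exact_mod_cast h7
    omega

/-- The number of points of `Λ` in the unit cube with lower corner `u`. -/
noncomputable def cellCount (Λ : Set (Fin d → ℝ)) (u : Fin d → ℤ) : ℕ :=
  (Λ ∩ floorVec ⁻¹' {u}).ncard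

theorem SeparatedBy.finite_floorVec {r : ℝ} (hr : 0 < r) {Λ : Set (Fin d → ℝ)}
    (h : SeparatedBy r Λ) (v : Fin d → ℤ) (A : Finset (Fin d → ℤ)) :
    {x ∈ Λ | floorVec x - v ∈ A}.Finite := by
  refine (A.finite_toSet.biUnion fun a _ =>
    h.finite_inter_closedBall hr (fun i => ((a + v) i : ℝ)) 1).subset fun x hx => ?_
  refine mem_biUnion hx.2 ⟨hx.1, ?_⟩
  rw [Metric.mem_closedBall, dist_pi_le_iff zero_le_one]
  intro i
  have h3 := Int.floor_le (x i)
  have h4 := Int.lt_floor_add_one (x i)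
  simp only [sub_add_cancel, floorVec, Real.dist_eq, abs_le]
  constructor <;> linarith

theorem SeparatedBy.sum_cellCount {r : ℝ} (hr : 0 < r) {Λ : Set (Fin d → ℝ)}
    (h : SeparatedBy r Λ) (v : Fin d → ℤ) (A : Finset (Fin d → ℤ)) :
    ∑ a ∈ A, cellCount Λ (a + v) = {x ∈ Λ | floorVec x - v ∈ A}.ncard := by
  classical
  have hfin := h.finite_floorVec hr v A
  rw [ncard_eq_toFinset_card _ hfin, Finset.card_eq_sum_card_fiberwise
    (f := fun x => floorVec x - v) (t := A) fun x hx => (hfin.mem_toFinset.1 hx).2]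
  refine Finset.sum_congr rfl fun a ha => ?_
  rw [cellCount, ← ncard_coe_finset]
  congr 1
  ext x
  simp only [mem_inter_iff, mem_preimage, mem_singleton_iff, Finset.coe_filter,
    Finite.mem_toFinset, mem_ofPred_eq, sub_eq_iff_eq_add]
  constructor
  · rintro ⟨hx, hx'⟩
    exact ⟨⟨hx, by rwa [hx', add_sub_cancel_right]⟩, hx'⟩
  · rintro ⟨⟨hx, _⟩, hx'⟩
    exact ⟨hx, hx'⟩

-- Shift the points by `-v`, apply the bijection between the two translates, and shift back by `w`.
-- A displacement of at most `C` changes the cell index by an element of the box.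
open scoped Pointwise in
theorem SeparatedBy.sum_cellCount_le {r C : ℝ} (hr : 0 < r) {Λ : Set (Fin d → ℝ)}
    (h : SeparatedBy r Λ)
    (hC : ∀ v w : Fin d → ℝ, BDWithin C ((fun x => v + x) '' Λ) ((fun x => w + x) '' Λ))
    (A : Finset (Fin d → ℤ)) (v w : Fin d → ℤ) :
    ∑ a ∈ A, cellCount Λ (a + v) ≤
      ∑ a ∈ A + intBox d (⌈C⌉₊ + 1), cellCount Λ (a + w) := by
  rw [h.sum_cellCount hr, h.sum_cellCount hr]
  have hfl : ∀ (x : Fin d → ℝ) (u : Fin d → ℤ),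
      floorVec ((fun i => -(u i : ℝ)) + x) = floorVec x - u := fun x u => by
    funext i
    simp only [floorVec, Pi.add_apply, Pi.sub_apply]
    rw [neg_add_eq_sub, Int.floor_sub_intCast]
  obtain ⟨f, hf, hinj, hfC⟩ := (hC (fun i => -(v i : ℝ)) fun i => -(w i : ℝ)).exists_injOn
  refine ncard_le_ncard_of_injOn
    (fun x => f ((fun i => -(v i : ℝ)) + x) - fun i => -(w i : ℝ)) ?_ ?_ (h.finite_floorVec hr _ _)
  · rintro x ⟨hx, hxA⟩
    have hx' := mem_image_of_mem (fun x => (fun i => -(v i : ℝ)) + x) hx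
    obtain ⟨y, hy, hxy⟩ := hf hx'
    have h1 := floorVec_sub_mem_intBox (hfC _ hx')
    simp only at hxy h1 ⊢
    rw [← hxy, add_sub_cancel_left]
    refine ⟨hy, ?_⟩
    rw [← hxy, hfl, hfl] at h1
    exact Finset.mem_add.2 ⟨_, hxA, _, h1, by abel⟩
  · rintro x ⟨hx, _⟩ y ⟨hy, _⟩ hxy
    simpa using hinj (mem_image_of_mem _ hx) (mem_image_of_mem _ hy) (sub_left_injective hxy)

/-! ### Matching with a grid of the same density -/

theorem exists_injective_of_counting {r C' : ℝ} (hr : 0 < r) {Λ Γ : Set (Fin d → ℝ)}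
    (hΓ : SeparatedBy r Γ)
    (h : ∀ F G : Finset (Fin d → ℝ), (F : Set (Fin d → ℝ)) ⊆ Λ →
      (∀ y, y ∈ G ↔ y ∈ Γ ∧ ∃ x ∈ F, ‖x - y‖ ≤ C') → F.card ≤ G.card) :
    ∃ f : Λ → Γ, Function.Injective f ∧
      ∀ x : Λ, ‖(x : Fin d → ℝ) - (f x : Fin d → ℝ)‖ ≤ C' := by
  refine exists_injective_of_hall (fun x => hΓ.finite_inter_closedBall hr x _) fun F hF => ?_
  have hfin : {y ∈ Γ | ∃ x ∈ F, ‖x - y‖ ≤ C'}.Finite := by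
    refine (F.finite_toSet.biUnion fun x _ => hΓ.finite_inter_closedBall hr x C').subset ?_
    rintro y ⟨hy, x, hx, hxy⟩
    refine mem_biUnion hx ⟨hy, ?_⟩
    rwa [Metric.mem_closedBall, dist_comm, dist_eq_norm]
  have hmem : ∀ y, y ∈ hfin.toFinset ↔ y ∈ Γ ∧ ∃ x ∈ F, ‖x - y‖ ≤ C' := fun y =>
    hfin.mem_toFinset
  exact ⟨hfin.toFinset, fun y hy => (hmem y).1 hy, h F _ hF hmem⟩

open scoped Pointwise in
/-- A uniformly discrete set which is equivalent to all its translates with a uniform bound on the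
displacement is equivalent to a cubic grid. -/
theorem exists_bdWithin_grid {r C : ℝ} (hd : d ≠ 0) (hr : 0 < r) {Λ : Set (Fin d → ℝ)}
    (h : SeparatedBy r Λ) (hne : Λ.Nonempty)
    (hC : ∀ v w : Fin d → ℝ, BDWithin C ((fun x => v + x) '' Λ) ((fun x => w + x) '' Λ)) :
    ∃ s > 0, ∃ C', BDWithin C' Λ (range (gridPoint (d := d) s)) := by
  set k : ℕ := ⌈C⌉₊ + 1
  set I := intBox d k
  obtain ⟨ρ, hρ⟩ := exists_density (cellCount Λ) I (h.sum_cellCount_le hr hC)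
  have hsum : ∀ A : Finset (Fin d → ℤ),
      ∑ a ∈ A, cellCount Λ a = {x ∈ Λ | floorVec x ∈ A}.ncard := fun A => by
    simpa using h.sum_cellCount hr 0 A
  have hfin : ∀ A : Finset (Fin d → ℤ), {x ∈ Λ | floorVec x ∈ A}.Finite := fun A => by
    simpa using h.finite_floorVec hr 0 A
  have hρpos : 0 < ρ := by
    obtain ⟨x, hx⟩ := hne
    have h1 := (hρ {floorVec x}).1
    rw [hsum] at h1
    have h2 : 0 < {y ∈ Λ | floorVec y ∈ ({floorVec x} : Finset _)}.ncard :=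
      (ncard_pos (hfin _)).2 ⟨x, hx, by simp⟩
    have h3 : (0 : ℝ) < {y ∈ Λ | floorVec y ∈ ({floorVec x} : Finset _)}.ncard := by
      exact_mod_cast h2
    exact pos_of_mul_pos_left (h3.trans_le h1) (Nat.cast_nonneg _)
  -- This side length gives the grid one point per volume `s ^ d = 1 / ρ`, the density of `Λ`.
  set s : ℝ := (1 / ρ) ^ ((d : ℝ)⁻¹)
  have hs : 0 < s := Real.rpow_pos_of_pos (by positivity) _
  have hsd : ρ * s ^ d = 1 := by
    rw [Real.rpow_inv_natCast_pow (by positivity) hd]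
    field_simp
  have hgrid := separatedBy_grid (d := d) hs
  have hone : ∀ p : Fin d → ℝ, p ∈ cube 1 (gridPoint 1 (floorVec p)) := fun p => by
    have h1 := mem_cube_gridPoint one_pos p
    simp only [div_one] at h1
    exact h1
  have hone' : ∀ (p : Fin d → ℝ) u, p ∈ cube 1 (gridPoint 1 u) → u = floorVec p := fun p u hp => by
    have h1 := eq_of_mem_cube_gridPoint one_pos hp
    simp only [div_one] at h1
    exact h1
  have hinj1 : Function.Injective (gridPoint (d := d) 1) := fun u v huv => by
    have h1 : gridPoint 1 u ∈ cube 1 (gridPoint (d := d) 1 u) := mem_cube.2 fun i => by simp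
    rw [hone' _ _ h1, hone' _ _ (huv ▸ h1 : gridPoint 1 u ∈ cube 1 (gridPoint 1 v))]
  obtain ⟨f, hf, hfC⟩ := exists_injective_of_counting (C' := k + 2 + s) (Λ := Λ) hs hgrid
    fun F G hF hG => by
      -- `|F|` is at most the count over `A`, hence at most `ρ |A + I|`. The unit cells of `A + I`
      -- are covered by the `s`-cubes of grid points in `G`, so this is at most `ρ s ^ d |G| = |G|`.
      set A := F.image floorVec
      have h1 : F.card ≤ {x ∈ Λ | floorVec x ∈ A}.ncard := by
        rw [← ncard_coe_finset]
        exact ncard_le_ncard (fun x hx => ⟨hF hx, Finset.mem_image_of_mem _ hx⟩) (hfin A)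
      have h2 := (hρ A).1
      rw [hsum] at h2
      have h3 := card_mul_pow_le_of_cubes zero_le_one hs.le (F := (A + I).image (gridPoint 1))
        (G := G) ((pairwiseDisjoint_cube_grid one_pos).subset (by simp)) (by
          intro x hx p hp
          obtain ⟨u, hu, rfl⟩ := Finset.mem_image.1 hx
          obtain ⟨a, ha, b, hb, rfl⟩ := Finset.mem_add.1 hu
          obtain ⟨z, hz, rfl⟩ := Finset.mem_image.1 ha
          refine ⟨_, (hG _).2 ⟨mem_range_self _, z, hz, ?_⟩, mem_cube_gridPoint hs p⟩
          refine (pi_norm_le_iff_of_nonneg (by positivity)).2 fun i => ?_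
          have e1 := mem_cube.1 (mem_cube_gridPoint hs p) i
          have e2 := mem_cube.1 hp i
          have e3 : |(b i : ℝ)| ≤ k := by exact_mod_cast mem_intBox.1 hb i
          have e4 := Int.floor_le (z i)
          have e5 := Int.lt_floor_add_one (z i)
          simp only [gridPoint, floorVec, Pi.add_apply, Int.cast_add, one_mul] at e1 e2
          rw [abs_le] at e3
          simp only [gridPoint, Pi.sub_apply, Real.norm_eq_abs, abs_le]
          constructor <;> linarith)
      rw [Finset.card_image_of_injective _ hinj1, one_pow, mul_one] at h3
      have h4 : (F.card : ℝ) ≤ G.card := calc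
        (F.card : ℝ) ≤ ρ * (A + I).card := le_trans (by exact_mod_cast h1) h2
        _ ≤ ρ * (G.card * s ^ d) := by gcongr
        _ = G.card := by rw [mul_left_comm, hsd, mul_one]
      exact_mod_cast h4
  obtain ⟨g, hg, hgC⟩ := exists_injective_of_counting (C' := k + 2 + s)
    (Λ := range (gridPoint (d := d) s)) hr h fun F G hF hG => by
      -- `A` contains all unit cells meeting the disjoint `s`-cubes based at `F`, so `|F| = ρ |F| s
      -- ^ d ≤ ρ |A|`. This is at most the count over `A + I`, whose points all lie in `G`.
      set A := F.biUnion fun y => Finset.Icc (floorVec y) (floorVec fun i => y i + s)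
      have h3 := card_mul_pow_le_of_cubes hs.le zero_le_one (F := F) (G := A.image (gridPoint 1))
        ((pairwiseDisjoint_cube_grid hs).subset hF) (by
          intro x hx p hp
          refine ⟨_, Finset.mem_image_of_mem _ (Finset.mem_biUnion.2 ⟨x, hx, Finset.mem_Icc.2
            ⟨fun i => ?_, fun i => ?_⟩⟩), hone p⟩
          · exact Int.floor_le_floor (mem_cube.1 hp i).1
          · exact Int.floor_le_floor (mem_cube.1 hp i).2.le)
      rw [Finset.card_image_of_injective _ hinj1, one_pow, mul_one] at h3
      have h2 := (hρ A).2
      rw [hsum] at h2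
      have h1 : {x ∈ Λ | floorVec x ∈ A + I}.ncard ≤ G.card := by
        rw [← ncard_coe_finset]
        refine ncard_le_ncard ?_ G.finite_toSet
        rintro x ⟨hx, hxA⟩
        obtain ⟨a, ha, b, hb, hab⟩ := Finset.mem_add.1 hxA
        obtain ⟨y, hy, hya⟩ := Finset.mem_biUnion.1 ha
        refine (hG x).2 ⟨hx, y, hy, ?_⟩
        refine (pi_norm_le_iff_of_nonneg (by positivity)).2 fun i => ?_
        have e1 : ((floorVec y i : ℤ) : ℝ) ≤ a i := by exact_mod_cast (Finset.mem_Icc.1 hya).1 i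
        have e2 : (a i : ℝ) ≤ (floorVec (fun i => y i + s) i : ℤ) := by
          exact_mod_cast (Finset.mem_Icc.1 hya).2 i
        have e3 : |(b i : ℝ)| ≤ k := by exact_mod_cast mem_intBox.1 hb i
        have e4 : (a i : ℝ) + b i = ⌊x i⌋ := by exact_mod_cast congrFun hab i
        have e5 := Int.floor_le (x i)
        have e6 := Int.lt_floor_add_one (x i)
        have e7 := Int.lt_floor_add_one (y i)
        have e8 := Int.floor_le (y i + s)
        simp only [floorVec] at e1 e2
        rw [abs_le] at e3
        simp only [Pi.sub_apply, Real.norm_eq_abs, abs_le]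
        constructor <;> linarith
      have h4 : (F.card : ℝ) ≤ G.card := calc
        (F.card : ℝ) = ρ * (F.card * s ^ d) := by rw [mul_left_comm, hsd, mul_one]
        _ ≤ ρ * A.card := by gcongr
        _ ≤ G.card := h2.trans (by exact_mod_cast h1)
      exact_mod_cast h4
  exact ⟨s, hs, _, .of_injective hf hg hfC hgC⟩

theorem exists_lattice_coe_eq_grid {s : ℝ} (hs : 0 < s) :
    ∃ (L : Submodule ℤ (Fin d → ℝ)) (_ : DiscreteTopology L), IsZLattice ℝ L ∧
      (L : Set (Fin d → ℝ)) = range (gridPoint (d := d) s) := by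
  set b := (Pi.basisFun ℝ (Fin d)).isUnitSMul fun _ => hs.ne'.isUnit with hb
  refine ⟨Submodule.span ℤ (range b), inferInstance, inferInstance, ?_⟩
  have hrepr : ∀ x i, b.repr x i = s⁻¹ * x i := fun x i => by
    rw [hb, Module.Basis.repr_isUnitSMul, Pi.basisFun_repr, Units.smul_def,
      Units.val_inv_eq_inv_val, IsUnit.unit_spec, smul_eq_mul]
  ext x
  rw [SetLike.mem_coe, Module.Basis.mem_span_iff_repr_mem]
  simp only [hrepr, mem_range]
  constructor
  · intro h
    choose u hu using h
    refine ⟨u, funext fun i => ?_⟩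
    have := hu i
    simp only [algebraMap_int_eq, eq_intCast] at this
    rw [gridPoint, this]
    field_simp
  · rintro ⟨u, rfl⟩ i
    refine ⟨u i, ?_⟩
    simp only [algebraMap_int_eq, eq_intCast, gridPoint]
    field_simp

theorem isUniformlySpread_of_translates {r C : ℝ} (hr : 0 < r) {Λ : Set (Fin d → ℝ)}
    (h : SeparatedBy r Λ) (hne : Λ.Nonempty)
    (hC : ∀ v w : Fin d → ℝ, BDWithin C ((fun x => v + x) '' Λ) ((fun x => w + x) '' Λ)) :
    IsUniformlySpread Λ := by
  -- In dimension `0` the side of the grid cannot encode a density, but the space is a single point.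
  rcases eq_or_ne d 0 with rfl | hd
  · obtain ⟨L, hL, hZ, _⟩ := exists_lattice_coe_eq_grid (d := 0) one_pos
    refine ⟨L, hL, hZ, ?_⟩
    rw [hne.eq_univ, (show (L : Set (Fin 0 → ℝ)).Nonempty from ⟨0, L.zero_mem⟩).eq_univ]
    exact (bdSetoid 0).refl _
  · obtain ⟨s, hs, C', hb⟩ := exists_bdWithin_grid hd hr h hne hC
    obtain ⟨L, hL, hZ, hLs⟩ := exists_lattice_coe_eq_grid (d := d) hs
    exact ⟨L, hL, hZ, hLs ▸ hb.bdEquiv⟩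

/-! ### Translates of uniformly spread sets -/

theorem BDWithin.image_add {C : ℝ} {Λ Γ : Set (Fin d → ℝ)} (h : BDWithin C Λ Γ)
    (v : Fin d → ℝ) : BDWithin C ((fun x => v + x) '' Λ) ((fun x => v + x) '' Γ) := by
  obtain ⟨φ, hφ⟩ := h
  let e := fun S : Set (Fin d → ℝ) => Equiv.Set.image (fun x => v + x) S (add_right_injective v)
  refine ⟨((e Λ).symm.trans φ).trans (e Γ), fun y => ?_⟩
  obtain ⟨x, rfl⟩ := (e Λ).surjective y
  simpa [e] using hφ x

theorem bdWithin_image_add_image_add (v w : Fin d → ℝ) (Λ : Set (Fin d → ℝ)) :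
    BDWithin ‖v - w‖ ((fun x => v + x) '' Λ) ((fun x => w + x) '' Λ) := by
  let e := fun v : Fin d → ℝ => Equiv.Set.image (fun x => v + x) Λ (add_right_injective v)
  refine ⟨(e v).symm.trans (e w), fun y => ?_⟩
  obtain ⟨x, rfl⟩ := (e v).surjective y
  simp [e]

/-- Modulo the lattice, `v` reduces to its fractional part, of norm at most `∑ i, ‖b i‖`; going from
`v +ᵥ Λ` to `v + L` and from `L` back to `Λ` costs `C` each. -/
theorem IsUniformlySpread.exists_bdWithin_vadd {Λ : ClosedSubset d}
    (h : IsUniformlySpread (Λ : Set (Fin d → ℝ))) :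
    ∃ C, ∀ v : Fin d → ℝ,
      BDWithin C ((v +ᵥ Λ : ClosedSubset d) : Set (Fin d → ℝ)) (Λ : Set (Fin d → ℝ)) := by
  obtain ⟨L, hL, hZ, φ, C, hφ⟩ := h
  set b := (Module.Free.chooseBasis ℤ L).ofZLatticeBasis ℝ L
  have hb : Submodule.span ℤ (range b) = L := Module.Basis.ofZLatticeBasis_span ℝ L _
  refine ⟨C + ∑ i, ‖b i‖ + C, fun v => ?_⟩
  obtain ⟨l, hl, hvl⟩ : ∃ l ∈ L, ‖v - l‖ ≤ ∑ i, ‖b i‖ :=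
    ⟨ZSpan.floor b v, hb.le (ZSpan.floor b v).2, ZSpan.norm_fract_le b v⟩
  have h1 : BDWithin C ((v +ᵥ Λ : ClosedSubset d) : Set (Fin d → ℝ))
      ((fun x => v + x) '' (L : Set (Fin d → ℝ))) := BDWithin.image_add ⟨φ, hφ⟩ v
  have h2 : BDWithin (∑ i, ‖b i‖) ((fun x => v + x) '' (L : Set (Fin d → ℝ)))
      (L : Set (Fin d → ℝ)) := by
    have h3 := (bdWithin_image_add_image_add v l (L : Set (Fin d → ℝ))).mono hvl
    have h4 : (fun x => l + x) '' (L : Set (Fin d → ℝ)) = L := by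
      ext x
      simp only [mem_image, SetLike.mem_coe]
      exact ⟨fun ⟨y, hy, hyx⟩ => hyx ▸ L.add_mem hl hy,
        fun hx => ⟨x - l, L.sub_mem hx hl, add_sub_cancel l x⟩⟩
    rwa [h4] at h3
  exact (h1.trans h2).trans (BDWithin.symm ⟨φ, hφ⟩)

/-! ### Minimal spaces and the dichotomy -/

theorem SeparatedBy.countable {r : ℝ} (hr : 0 < r) {Λ : Set (Fin d → ℝ)} (h : SeparatedBy r Λ) :
    Λ.Countable := by
  refine (countable_iUnion fun n : ℕ =>
    (h.finite_inter_closedBall hr 0 n).countable).mono fun x hx => ?_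
  obtain ⟨n, hn⟩ := exists_nat_ge ‖x‖
  exact mem_iUnion.2 ⟨n, hx, by simpa using hn⟩

theorem BD_le_continuum {X : Set (ClosedSubset d)}
    (h : ∀ Λ ∈ X, IsDelone (Λ : Set (Fin d → ℝ))) : BD X ≤ 2 ^ Cardinal.aleph0 := by
  refine Cardinal.mk_image_le.trans ?_
  have hex : ∀ Λ : X, ∃ f : ℕ → Fin d → ℝ, ((Λ : ClosedSubset d) : Set (Fin d → ℝ)) = range f :=
    fun Λ => by
      obtain ⟨r, hr, hs⟩ := (h Λ Λ.2).exists_separatedBy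
      exact (hs.countable hr).exists_eq_range (h Λ Λ.2).nonempty
  choose f hf using hex
  have hinj : Function.Injective f := fun Λ Γ hΛΓ =>
    Subtype.ext (SetLike.coe_injective (by rw [hf, hf, hΛΓ]))
  refine (Cardinal.mk_le_of_injective (β := ℕ → Fin d → ℝ) hinj).trans ?_
  rw [Cardinal.two_power_aleph0]
  have h1 : Cardinal.mk (Fin d → ℝ) ≤ Cardinal.continuum := by
    rw [← Cardinal.power_def, Cardinal.mk_real, Cardinal.mk_fin]
    exact (Cardinal.power_le_power_left Cardinal.continuum_ne_zero
      Cardinal.natCast_lt_aleph0.le).trans Cardinal.continuum_power_aleph0.le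
  rw [← Cardinal.power_def, Cardinal.mk_nat]
  exact (Cardinal.power_le_power_right h1).trans Cardinal.continuum_power_aleph0.le

theorem exists_uniform_separatedBy {X : Set (ClosedSubset d)} (hne : X.Nonempty)
    (hDelone : ∀ Λ ∈ X, IsDelone (Λ : Set (Fin d → ℝ)))
    (hminimal : ∀ Λ ∈ X, X ⊆ closure (AddAction.orbit (Fin d → ℝ) Λ)) :
    ∃ r > 0, ∀ Λ ∈ X, SeparatedBy r (Λ : Set (Fin d → ℝ)) := by
  obtain ⟨Λ, hΛ⟩ := hne
  obtain ⟨r, hr, hs⟩ := (hDelone Λ hΛ).exists_separatedBy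
  refine ⟨r, hr, fun Γ hΓ => .of_mem_closure (S := AddAction.orbit (Fin d → ℝ) Λ) ?_
    (hminimal Λ hΛ hΓ)⟩
  rintro _ ⟨v, rfl⟩
  exact hs.vadd v

/-- The displacement bound between `v +ᵥ Λ` and `Λ` does not depend on `v`, so it passes to limits
of translates. -/
theorem IsUniformlySpread.exists_bdWithin_of_mem_closure_orbit {r : ℝ} (hr : 0 < r)
    {Λ Γ : ClosedSubset d} (hΛ : SeparatedBy r (Λ : Set (Fin d → ℝ)))
    (h : IsUniformlySpread (Λ : Set (Fin d → ℝ)))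
    (hΓ : Γ ∈ closure (AddAction.orbit (Fin d → ℝ) Λ)) :
    ∃ C, BDWithin C (Γ : Set (Fin d → ℝ)) (Λ : Set (Fin d → ℝ)) := by
  obtain ⟨C, hC⟩ := h.exists_bdWithin_vadd
  have hΓs : SeparatedBy r (Γ : Set (Fin d → ℝ)) := by
    refine .of_mem_closure (S := AddAction.orbit (Fin d → ℝ) Λ) ?_ hΓ
    rintro _ ⟨v, rfl⟩
    exact hΛ.vadd v
  refine ⟨C + 1, .of_approx hr hΓs hΛ fun ε hε => ?_⟩
  obtain ⟨_, ⟨v, rfl⟩, hv⟩ := Metric.mem_closure_iff.1 hΓ (min ε 1) (lt_min hε one_pos)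
  refine ⟨_, _, cfClose_of_dist_lt hε hv, cfClose_of_dist_lt (Γ := Λ) hε ?_, hΛ.vadd v, hΛ, hC v⟩
  rw [dist_self]
  exact lt_min hε one_pos

theorem bdWithin_of_mem_closure {r C : ℝ} (hr : 0 < r) {X : Set (ClosedSubset d)}
    (hs : ∀ Λ ∈ X, SeparatedBy r (Λ : Set (Fin d → ℝ))) {p : X × X}
    (hp : p ∈ closure {q : X × X | BDWithin C ((q.1 : ClosedSubset d) : Set (Fin d → ℝ))
      ((q.2 : ClosedSubset d) : Set (Fin d → ℝ))}) :
    BDWithin (C + 1) ((p.1 : ClosedSubset d) : Set (Fin d → ℝ))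
      ((p.2 : ClosedSubset d) : Set (Fin d → ℝ)) := by
  refine .of_approx hr (hs _ p.1.2) (hs _ p.2.2) fun ε hε => ?_
  obtain ⟨q, hq, hpq⟩ := Metric.mem_closure_iff.1 hp (min ε 1) (lt_min hε one_pos)
  rw [Prod.dist_eq, max_lt_iff] at hpq
  exact ⟨_, _, cfClose_of_dist_lt hε hpq.1, cfClose_of_dist_lt hε hpq.2, hs _ q.1.2, hs _ q.2.2, hq⟩

/-- If all elements of a nonempty open part of a minimal compact space are uniformly equivalent,
then so are all elements of the space. -/
theorem exists_bdWithin_of_open {X : Set (ClosedSubset d)} (hcompact : IsCompact X)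
    (hinvariant : ∀ v : Fin d → ℝ, ∀ Λ ∈ X, v +ᵥ Λ ∈ X)
    (hminimal : ∀ Λ ∈ X, X ⊆ closure (AddAction.orbit (Fin d → ℝ) Λ))
    {O : Set (ClosedSubset d)} (hO : IsOpen O) (hne : (O ∩ X).Nonempty) {C : ℝ}
    (h : ∀ Λ ∈ O ∩ X, ∀ Γ ∈ O ∩ X, BDWithin C (Λ : Set (Fin d → ℝ)) (Γ : Set (Fin d → ℝ))) :
    ∃ C', ∀ Λ ∈ X, ∀ Γ ∈ X, BDWithin C' (Λ : Set (Fin d → ℝ)) (Γ : Set (Fin d → ℝ)) := by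
  obtain ⟨Δ, hΔO, hΔX⟩ := hne
  -- Every orbit is dense in `X` and so meets `O`; compactness leaves finitely many return vectors,
  -- bounded by `M`.
  obtain ⟨t, ht⟩ := hcompact.elim_finite_subcover
    (fun v : Fin d → ℝ => (fun Λ : ClosedSubset d => v +ᵥ Λ) ⁻¹' O)
    (fun v => hO.preimage (continuous_vadd_closedSubset v)) fun Λ hΛ => by
      obtain ⟨_, hv, ⟨v, rfl⟩⟩ := mem_closure_iff.1 (hminimal Λ hΛ hΔX) O hO hΔO
      exact mem_iUnion.2 ⟨v, hv⟩
  obtain ⟨M, hM⟩ := t.finite_toSet.isBounded.exists_norm_le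
  have hret : ∀ Λ ∈ X, ∃ Λ' ∈ O ∩ X,
      BDWithin M (Λ : Set (Fin d → ℝ)) (Λ' : Set (Fin d → ℝ)) := fun Λ hΛ => by
    obtain ⟨v, hv, hvO⟩ := mem_iUnion₂.1 (ht hΛ)
    exact ⟨v +ᵥ Λ, ⟨hvO, hinvariant v Λ hΛ⟩, (bdWithin_vadd v Λ).mono (hM v hv)⟩
  refine ⟨M + C + M, fun Λ hΛ Γ hΓ => ?_⟩
  obtain ⟨Λ', hΛ', h1⟩ := hret Λ hΛ
  obtain ⟨Γ', hΓ', h2⟩ := hret Γ hΓ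
  exact (h1.trans (h Λ' hΛ' Γ' hΓ')).trans h2.symm

theorem isUniformlySpread_or_continuum_le {X : Set (ClosedSubset d)} (hne : X.Nonempty)
    (hDelone : ∀ Λ ∈ X, IsDelone (Λ : Set (Fin d → ℝ))) (hcompact : IsCompact X)
    (hinvariant : ∀ v : Fin d → ℝ, ∀ Λ ∈ X, v +ᵥ Λ ∈ X)
    (hminimal : ∀ Λ ∈ X, X ⊆ closure (AddAction.orbit (Fin d → ℝ) Λ)) :
    (∃ Λ ∈ X, IsUniformlySpread (Λ : Set (Fin d → ℝ))) ∨ 2 ^ Cardinal.aleph0 ≤ BD X := by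
  obtain ⟨r, hr, hs⟩ := exists_uniform_separatedBy hne hDelone hminimal
  let R : ℕ → Set (X × X) := fun n => {q : X × X |
    BDWithin n ((q.1 : ClosedSubset d) : Set (Fin d → ℝ))
      ((q.2 : ClosedSubset d) : Set (Fin d → ℝ))}
  have hR : Monotone R := fun m n hmn q hq => BDWithin.mono (by exact_mod_cast hmn) hq
  by_cases hsp : ∀ n, IsSparse (closure (R n))
  · right
    have : CompactSpace X := isCompact_iff_compactSpace.1 hcompact
    have : Nonempty X := hne.to_subtype
    obtain ⟨f, hf⟩ := exists_cantor_family hsp fun m n hmn => closure_mono (hR hmn)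
    have h1 : Cardinal.mk (ℕ → Bool) = 2 ^ Cardinal.aleph0 := by simp
    rw [← h1]
    refine Cardinal.mk_le_of_injective (f := fun a => (⟨_, mem_image_of_mem _ (f a).2⟩ :
      (fun Λ : ClosedSubset d => Quotient.mk (bdSetoid d) (Λ : Set (Fin d → ℝ))) '' X))
      fun a b hab => ?_
    by_contra hne
    obtain ⟨C, hC⟩ := bdEquiv_iff.1 (Quotient.exact (congrArg Subtype.val hab))
    obtain ⟨n, hn⟩ := exists_nat_ge C
    exact hf a b hne n (subset_closure (hC.mono hn))
  · left
    simp only [IsSparse, isClosed_closure, true_and, not_forall, not_not] at hsp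
    obtain ⟨n, U, V, hU, _, hUne, ⟨z, hz⟩, hUV⟩ := hsp
    obtain ⟨O, hO, rfl⟩ := isOpen_induced_iff.1 hU
    -- Fixing one `z` in the second side of the rectangle makes it a common reference point for the
    -- whole first side.
    have h1 : ∀ Λ ∈ O ∩ X, BDWithin (n + 1) (Λ : Set (Fin d → ℝ))
        ((z : ClosedSubset d) : Set (Fin d → ℝ)) := fun Λ hΛ =>
      bdWithin_of_mem_closure hr hs (hUV (mk_mem_prod (a := ⟨Λ, hΛ.2⟩) hΛ.1 hz))
    obtain ⟨x, hx⟩ := hUne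
    obtain ⟨C, hC⟩ := exists_bdWithin_of_open hcompact hinvariant hminimal hO ⟨x, hx, x.2⟩
      fun Λ hΛ Γ hΓ => (h1 Λ hΛ).trans (h1 Γ hΓ).symm
    obtain ⟨Λ, hΛ⟩ := hne
    exact ⟨Λ, hΛ, isUniformlySpread_of_translates hr (hs Λ hΛ) (hDelone Λ hΛ).nonempty
      fun v w => hC _ (hinvariant v Λ hΛ) _ (hinvariant w Λ hΛ)⟩

theorem IsUniformlySpread.of_bdEquiv {Λ Γ : Set (Fin d → ℝ)} (h : IsUniformlySpread Λ)
    (hΓ : BDEquiv Γ Λ) : IsUniformlySpread Γ := by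
  obtain ⟨L, hL, hZ, hΛ⟩ := h
  exact ⟨L, hL, hZ, (bdSetoid d).trans hΓ hΛ⟩

theorem forall_isUniformlySpread_and_BD_eq_one {X : Set (ClosedSubset d)}
    (hDelone : ∀ Λ ∈ X, IsDelone (Λ : Set (Fin d → ℝ)))
    (hminimal : ∀ Λ ∈ X, X ⊆ closure (AddAction.orbit (Fin d → ℝ) Λ))
    (h : ∃ Λ ∈ X, IsUniformlySpread (Λ : Set (Fin d → ℝ))) :
    (∀ Λ ∈ X, IsUniformlySpread (Λ : Set (Fin d → ℝ))) ∧ BD X = 1 := by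
  obtain ⟨Λ, hΛ, hu⟩ := h
  obtain ⟨r, hr, hs⟩ := (hDelone Λ hΛ).exists_separatedBy
  have hb : ∀ Γ ∈ X, BDEquiv (Γ : Set (Fin d → ℝ)) (Λ : Set (Fin d → ℝ)) := fun Γ hΓ =>
    bdEquiv_iff.2 (hu.exists_bdWithin_of_mem_closure_orbit hr hs (hminimal Λ hΛ hΓ))
  refine ⟨fun Γ hΓ => hu.of_bdEquiv (hb Γ hΓ), ?_⟩
  have himg : (fun Λ : ClosedSubset d => Quotient.mk (bdSetoid d) (Λ : Set (Fin d → ℝ))) '' X =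
      {Quotient.mk (bdSetoid d) (Λ : Set (Fin d → ℝ))} :=
    eq_singleton_iff_unique_mem.2 ⟨mem_image_of_mem _ hΛ, by
      rintro _ ⟨Γ, hΓ, rfl⟩
      exact Quotient.sound (hb Γ hΓ)⟩
  rw [BD, himg, Cardinal.mk_singleton]

end DeloneBD

open DeloneBD in
theorem theorem1p1 (d : ℕ) (X : Set (ClosedSubset d))
    (hne : X.Nonempty)
    (hDelone : ∀ Λ ∈ X, IsDelone (Λ : Set (Fin d → ℝ)))
    (hcompact : IsCompact X)
    (hinvariant : ∀ v : Fin d → ℝ, ∀ Λ ∈ X, v +ᵥ Λ ∈ X)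
    (hminimal : ∀ Λ ∈ X, X ⊆ closure (AddAction.orbit (Fin d → ℝ) Λ)) :
    Xor (∃ Λ ∈ X, IsUniformlySpread (Λ : Set (Fin d → ℝ)))
      (BD X = 2 ^ Cardinal.aleph0) ∧
      ((∃ Λ ∈ X, IsUniformlySpread (Λ : Set (Fin d → ℝ))) →
        (∀ Λ ∈ X, IsUniformlySpread (Λ : Set (Fin d → ℝ))) ∧ BD X = 1) := by
  have hone := forall_isUniformlySpread_and_BD_eq_one hDelone hminimal
  refine ⟨?_, hone⟩
  by_cases h : ∃ Λ ∈ X, IsUniformlySpread (Λ : Set (Fin d → ℝ))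
  · refine Or.inl ⟨h, ?_⟩
    rw [(hone h).2]
    exact (Cardinal.one_lt_aleph0.trans (Cardinal.cantor _)).ne
  · exact Or.inr ⟨(BD_le_continuum hDelone).antisymm ((isUniformlySpread_or_continuum_le hne hDelone
      hcompact hinvariant hminimal).resolve_left h), h⟩
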